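/- Let $N\ge 2$ and let $\Omega\subset\mathbb R^N$ be a bounded open set with Lipschitz boundary. Let $0<s<1<p<N$ and $\frac{N}{sp}<q<\infty$, and let $V,g\in L^q(\Omega)$ satisfy $V\ge 0$ and $g>0$ a.e. in $\Omega$. Set $$X_0^{s,p}(\Omega)=\{u\in W^{1,p}(\mathbb R^N):\ u|_\Omega\in W^{1,p}_0(\Omega),\ u=0 \text{ a.e. in } \mathbb R^N\setminus\Omega\},$$ where $W^{1,p}_0(\Omega)$ is the closure of $C_c^\infty(\Omega)$ in $W^{1,p}(\Omega)$. Let $\lambda>0$ be an eigenvalue, with eigenfunction $u$, of the problem $$-\Delta_p u+(-\Delta_p)^s u+V|u|^{p-2}u=\lambda g|u|^{p-2}u\ \text{ in }\Omega,\qquad u=0\ \text{ in }\mathbb R^N\setminus\Omega;$$ that is, $u\in X_0^{s,p}(\Omega)\setminus\{0\}$ and, for every $v\in X_0^{s,p}(\Omega)$, $$\int_\Omega|\nabla u|^{p-2}\nabla u\cdot\nabla v\,dx+\int_{\mathbb R^N}\int_{\mathbb R^N}\frac{|u(x)-u(y)|^{p-2}(u(x)-u(y))(v(x)-v(y))}{|x-y|^{N+ps}}\,dx\,dy+\int_\Omega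 V|u|^{p-2}uv\,dx=\lambda\int_\Omega g|u|^{p-2}uv\,dx.$$ Then $u\in L^\infty(\mathbb R^N)$. -/

import Mathlib

open MeasureTheory Set
open scoped ContDiff

namespace MixedEigenvalue

/-- `Ω` has Lipschitz boundary: near each boundary point, in a suitable direction `ν`, the set `Ω`
is exactly the region lying strictly above the graph of a Lipschitz function defined on the
hyperplane orthogonal to `ν`. -/
def HasLipschitzBoundary {N : ℕ} (Ω : Set (EuclideanSpace ℝ (Fin N))) : Prop :=
  ∀ x₀ ∈ frontier Ω, ∃ ν : EuclideanSpace ℝ (Fin N), ‖ν‖ = 1 ∧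
    ∃ (K : NNReal) (γ : (Submodule.span ℝ {ν})ᗮ → ℝ), LipschitzWith K γ ∧
      ∃ r > 0, ∀ x ∈ Metric.ball x₀ r,
        (x ∈ Ω ↔ γ ((Submodule.span ℝ {ν})ᗮ.orthogonalProjectionOnto x) < inner ℝ ν x)

/-- `φ ∈ C_c^∞(Ω)`. -/
structure IsTestFunction {N : ℕ} (Ω : Set (EuclideanSpace ℝ (Fin N)))
    (φ : EuclideanSpace ℝ (Fin N) → ℝ) : Prop where
  smooth : ContDiff ℝ ∞ φ
  compact : HasCompactSupport φ
  support_subset : tsupport φ ⊆ Ω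

/-- `G` is a weak (distributional) gradient of `u` in the open set `Ω`. -/
structure HasWeakGradientOn {N : ℕ} (Ω : Set (EuclideanSpace ℝ (Fin N)))
    (u : EuclideanSpace ℝ (Fin N) → ℝ)
    (G : EuclideanSpace ℝ (Fin N) → EuclideanSpace ℝ (Fin N)) : Prop where
  locallyIntegrable : LocallyIntegrableOn u Ω volume
  locallyIntegrable_grad : LocallyIntegrableOn G Ω volume
  integral_eq : ∀ φ : EuclideanSpace ℝ (Fin N) → ℝ, IsTestFunction Ω φ → ∀ i : Fin N,
    ∫ x in Ω, u x * gradient φ x i = - ∫ x in Ω, G x i * φ x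

/-- `u ∈ W^{1,p}(Ω)`. -/
def MemW1p {N : ℕ} (p : ℝ) (Ω : Set (EuclideanSpace ℝ (Fin N)))
    (u : EuclideanSpace ℝ (Fin N) → ℝ) : Prop :=
  MemLp u (ENNReal.ofReal p) (volume.restrict Ω) ∧
    ∃ G, HasWeakGradientOn Ω u G ∧ MemLp G (ENNReal.ofReal p) (volume.restrict Ω)

/-- `u ∈ W_0^{1,p}(Ω)`: `u ∈ W^{1,p}(Ω)` lies in the closure of `C_c^∞(Ω)` for the Sobolev norm.
(The equivalent norm `‖u‖_{L^p(Ω)} + ‖∇u‖_{L^p(Ω)}` is used to express closeness.) -/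
def MemW1pZero {N : ℕ} (p : ℝ) (Ω : Set (EuclideanSpace ℝ (Fin N)))
    (u : EuclideanSpace ℝ (Fin N) → ℝ) : Prop :=
  MemLp u (ENNReal.ofReal p) (volume.restrict Ω) ∧
    ∃ G, HasWeakGradientOn Ω u G ∧ MemLp G (ENNReal.ofReal p) (volume.restrict Ω) ∧
      ∀ ε : ENNReal, 0 < ε → ∃ φ : EuclideanSpace ℝ (Fin N) → ℝ, IsTestFunction Ω φ ∧
        eLpNorm (fun x => u x - φ x) (ENNReal.ofReal p) (volume.restrict Ω) +
          eLpNorm (fun x => G x - gradient φ x) (ENNReal.ofReal p) (volume.restrict Ω) < ε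

/-- The weak gradient of `u` on the whole space, for `u` that has one (it is then unique up to
equality almost everywhere). -/
noncomputable def weakGradient {N : ℕ} (u : EuclideanSpace ℝ (Fin N) → ℝ) :
    EuclideanSpace ℝ (Fin N) → EuclideanSpace ℝ (Fin N) :=
  Classical.epsilon (fun G => HasWeakGradientOn univ u G)

/-- The solution space `X_0(Ω)`: functions in `W^{1,p}(ℝ^N)` whose restriction to `Ω` lies in
`W_0^{1,p}(Ω)` and which vanish outside `Ω`. -/
structure MemX {N : ℕ} (p : ℝ) (Ω : Set (EuclideanSpace ℝ (Fin N)))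
    (u : EuclideanSpace ℝ (Fin N) → ℝ) : Prop where
  memW1p : MemW1p p univ u
  memW1pZero : MemW1pZero p Ω u
  ae_eq_zero : ∀ᵐ x ∂(volume : Measure (EuclideanSpace ℝ (Fin N))), x ∉ Ω → u x = 0

/-- The local part `∫_Ω |∇u|^{p-2} ∇u · ∇v dx`. -/
noncomputable def localForm {N : ℕ} (p : ℝ) (Ω : Set (EuclideanSpace ℝ (Fin N)))
    (u v : EuclideanSpace ℝ (Fin N) → ℝ) : ℝ :=
  ∫ x in Ω, ‖weakGradient u x‖ ^ (p - 2) * inner ℝ (weakGradient u x) (weakGradient v x)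

/-- The nonlocal part, a double integral over `ℝ^N × ℝ^N`. -/
noncomputable def nonlocalForm {N : ℕ} (s p : ℝ)
    (u v : EuclideanSpace ℝ (Fin N) → ℝ) : ℝ :=
  ∫ z : EuclideanSpace ℝ (Fin N) × EuclideanSpace ℝ (Fin N),
    |u z.1 - u z.2| ^ (p - 2) * (u z.1 - u z.2) * (v z.1 - v z.2) /
      ‖z.1 - z.2‖ ^ ((N : ℝ) + p * s)

/-- `u` is a weak solution of `-Δ_p u + (-Δ_p)^s u + V |u|^{p-2} u = lam g |u|^{p-2} u` in `Ω`,
`u = 0` in the complement of `Ω`. -/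
def IsWeakSolution {N : ℕ} (s p : ℝ) (Ω : Set (EuclideanSpace ℝ (Fin N)))
    (V g : EuclideanSpace ℝ (Fin N) → ℝ) (lam : ℝ) (u : EuclideanSpace ℝ (Fin N) → ℝ) : Prop :=
  MemX p Ω u ∧ ∀ v : EuclideanSpace ℝ (Fin N) → ℝ, MemX p Ω v →
    localForm p Ω u v + nonlocalForm s p u v
      + (∫ x in Ω, V x * |u x| ^ (p - 2) * u x * v x)
      - lam * (∫ x in Ω, g x * |u x| ^ (p - 2) * u x * v x) = 0

/-- `u` is an eigenfunction for the eigenvalue `lam`: a weak solution that is not (a.e.) zero. -/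
def IsEigenfunction {N : ℕ} (s p : ℝ) (Ω : Set (EuclideanSpace ℝ (Fin N)))
    (V g : EuclideanSpace ℝ (Fin N) → ℝ) (lam : ℝ) (u : EuclideanSpace ℝ (Fin N) → ℝ) : Prop :=
  IsWeakSolution s p Ω V g lam u ∧
    ¬ (∀ᵐ x ∂(volume : Measure (EuclideanSpace ℝ (Fin N))), u x = 0)

end MixedEigenvalue

namespace MixedEigenvalue

open Filter Topology

/-! The proof is a De Giorgi–Stampacchia iteration on the level sets `{k < |u|}`. Test the equation
with `F(u)`, where `F` is a nondecreasing truncation vanishing on `[-k, k]` with slope at most `1`.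
Monotonicity makes the nonlocal and the potential terms nonnegative, so they can be dropped, leaving
`‖∇F(u)‖_p^p ≤ lam ∫ |g| |u|^(p-1) |F(u)|`.

With `1/r = 1/p - 1/N`, the Sobolev inequality bounds `‖F(u)‖_r^p` by a multiple of the right side.
On `{k < |u|}` one has `|u| ≤ |F(u)| + m`, and Hölder's inequality produces a multiple of
`‖F(u)‖_r^p` with factor `|{k < |u|}|^(p/N - 1/q)`. This exponent is positive because `q > N/p`, so
the term is absorbed for large `k`. Chebyshev's inequality then bounds `|{h < |u|}|^(1 - p/N)` by a
multiple of `|{k < |u|}|^(1 - 1/q)`. Since `1 - 1/q > 1 - p/N`, the decay is superlinear, and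
iterating along bounded increasing levels gives a level whose superlevel set is null.

The main steps are `IsWeakSolution.lintegral_grad_le` (energy),
`IsWeakSolution.exists_level_set_estimate` (decay) and
`exists_measure_eq_zero_of_level_set_estimate` (iteration). Admissibility of `F(u)` comes from the
chain rule `IsSobolevLimit.comp`. -/

theorem tendsto_integral_mul_of_tendsto_eLpNorm {α : Type*} [MeasurableSpace α] {μ : Measure α}
    {P Q : ENNReal} [P.HolderConjugate Q] {f : ℕ → α → ℝ} {g ψ : α → ℝ}
    (hf : ∀ n, MemLp (f n) P μ) (hg : MemLp g P μ) (hψ : MemLp ψ Q μ)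
    (h : Tendsto (fun n => eLpNorm (fun x => f n x - g x) P μ) atTop (𝓝 0)) :
    Tendsto (fun n => ∫ x, f n x * ψ x ∂μ) atTop (𝓝 (∫ x, g x * ψ x ∂μ)) := by
  refine tendsto_integral_of_L1 _ (hg.1.mul hψ.1)
    (Eventually.of_forall fun n => (hf n).integrable_mul hψ) ?_
  have h0 : Tendsto (fun n => eLpNorm (fun x => f n x - g x) P μ * eLpNorm ψ Q μ) atTop (𝓝 0) := by
    simpa using ENNReal.Tendsto.mul_const h (Or.inr hψ.2.ne)
  refine tendsto_of_tendsto_of_tendsto_of_le_of_le tendsto_const_nhds h0 (fun _ => zero_le) ?_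
  intro n
  have := eLpNorm_smul_le_mul_eLpNorm (p := P) (q := Q) (r := 1) hψ.1 ((hf n).1.sub hg.1)
  rw [eLpNorm_one_eq_lintegral_enorm] at this
  refine le_trans (le_of_eq ?_) this
  refine lintegral_congr fun x => ?_
  simp [sub_mul]

variable {N : ℕ}

/-! ### Calculus of test functions. -/

theorem gradient_apply_eq_fderiv (f : EuclideanSpace ℝ (Fin N) → ℝ)
    (x : EuclideanSpace ℝ (Fin N)) (i : Fin N) :
    gradient f x i = fderiv ℝ f x (EuclideanSpace.single i 1) := by
  rw [← inner_gradient_left, EuclideanSpace.inner_single_right]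
  simp

theorem norm_gradient (f : EuclideanSpace ℝ (Fin N) → ℝ) (x : EuclideanSpace ℝ (Fin N)) :
    ‖gradient f x‖ = ‖fderiv ℝ f x‖ := by
  simp [gradient]

namespace IsTestFunction

variable {Ω U : Set (EuclideanSpace ℝ (Fin N))} {φ ψ : EuclideanSpace ℝ (Fin N) → ℝ}

theorem continuous (h : IsTestFunction Ω φ) : Continuous φ := h.smooth.continuous

theorem differentiable (h : IsTestFunction Ω φ) : Differentiable ℝ φ :=
  h.smooth.differentiable (by simp)

theorem continuous_gradient (h : IsTestFunction Ω φ) : Continuous (gradient φ) :=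
  (InnerProductSpace.toDual ℝ _).symm.continuous.comp (h.smooth.continuous_fderiv (by simp))

theorem gradient_eq_zero_of_notMem (x : EuclideanSpace ℝ (Fin N)) (hx : x ∉ tsupport φ) :
    gradient φ x = 0 := by
  have : fderiv ℝ φ x = 0 := by
    by_contra hne
    exact hx (support_fderiv_subset ℝ hne)
  simp [gradient, this]

theorem hasCompactSupport_gradient (h : IsTestFunction Ω φ) : HasCompactSupport (gradient φ) :=
  HasCompactSupport.intro h.compact fun x hx => gradient_eq_zero_of_notMem x hx

theorem memLp (h : IsTestFunction Ω φ) (P : ENNReal) : MemLp φ P volume :=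
  h.continuous.memLp_of_hasCompactSupport h.compact

theorem memLp_gradient (h : IsTestFunction Ω φ) (P : ENNReal) : MemLp (gradient φ) P volume :=
  h.continuous_gradient.memLp_of_hasCompactSupport h.hasCompactSupport_gradient

theorem continuous_gradient_apply (h : IsTestFunction Ω φ) (i : Fin N) :
    Continuous fun x => gradient φ x i :=
  (EuclideanSpace.proj (𝕜 := ℝ) i).continuous.comp h.continuous_gradient

theorem hasCompactSupport_gradient_apply (h : IsTestFunction Ω φ) (i : Fin N) :
    HasCompactSupport fun x => gradient φ x i :=
  HasCompactSupport.intro h.compact fun x hx => by simp [gradient_eq_zero_of_notMem x hx]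

theorem eq_zero_of_notMem (h : IsTestFunction Ω φ) {x : EuclideanSpace ℝ (Fin N)} (hx : x ∉ Ω) :
    φ x = 0 := image_eq_zero_of_notMem_tsupport fun h' => hx (h.support_subset h')

theorem gradient_eq_zero (h : IsTestFunction Ω φ) {x : EuclideanSpace ℝ (Fin N)} (hx : x ∉ Ω) :
    gradient φ x = 0 := gradient_eq_zero_of_notMem x fun h' => hx (h.support_subset h')

theorem integral_mul_gradient (h : IsTestFunction Ω φ) (h' : IsTestFunction U ψ) (i : Fin N) :
    ∫ x, φ x * gradient ψ x i = - ∫ x, gradient φ x i * ψ x := by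
  have h1 := integral_mul_fderiv_eq_neg_fderiv_mul_of_integrable (μ := volume) (f := φ) (g := ψ)
    (v := EuclideanSpace.single i (1 : ℝ)) ?_ ?_ ?_ (fun x _ => h.differentiable x)
    (fun x _ => h'.differentiable x)
  · simpa only [gradient_apply_eq_fderiv] using h1
  · simp only [← gradient_apply_eq_fderiv]
    exact ((h.continuous_gradient_apply i).mul h'.continuous).integrable_of_hasCompactSupport
      (h'.compact.mul_left)
  · simp only [← gradient_apply_eq_fderiv]
    exact (h.continuous.mul (h'.continuous_gradient_apply i)).integrable_of_hasCompactSupport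
      (h.compact.mul_right)
  · exact (h.continuous.mul h'.continuous).integrable_of_hasCompactSupport (h.compact.mul_right)

theorem comp (h : IsTestFunction Ω φ) {F : ℝ → ℝ} (hF : ContDiff ℝ ∞ F) (hF0 : F 0 = 0) :
    IsTestFunction Ω (F ∘ φ) where
  smooth := hF.comp h.smooth
  compact := h.compact.comp_left hF0
  support_subset := (closure_mono (Function.support_comp_subset hF0 φ)).trans h.support_subset

theorem gradient_comp (h : IsTestFunction Ω φ) {F : ℝ → ℝ} (hF : ContDiff ℝ ∞ F)
    (x : EuclideanSpace ℝ (Fin N)) : gradient (F ∘ φ) x = deriv F (φ x) • gradient φ x := by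
  have hd : DifferentiableAt ℝ F (φ x) := (hF.differentiable (by simp)) _
  have := hd.hasDerivAt.comp_hasFDerivAt x (h.differentiable x).hasFDerivAt
  rw [gradient, this.fderiv, gradient]
  simp

end IsTestFunction

/-! ### Sobolev limits of test functions and the chain rule. -/

/-- The pair `(u, H)` is the limit, in `L^P(ℝ^N)` together with gradients and almost everywhere,
of a sequence of test functions supported in `Ω`. -/
structure IsSobolevLimit (P : ENNReal) (Ω : Set (EuclideanSpace ℝ (Fin N)))
    (u : EuclideanSpace ℝ (Fin N) → ℝ)
    (H : EuclideanSpace ℝ (Fin N) → EuclideanSpace ℝ (Fin N)) : Prop where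
  memLp : MemLp u P volume
  memLp_grad : MemLp H P volume
  exists_seq : ∃ φ : ℕ → EuclideanSpace ℝ (Fin N) → ℝ, (∀ n, IsTestFunction Ω (φ n)) ∧
    Tendsto (fun n => eLpNorm (fun x => φ n x - u x) P volume) atTop (𝓝 0) ∧
    Tendsto (fun n => eLpNorm (fun x => gradient (φ n) x - H x) P volume) atTop (𝓝 0) ∧
    ∀ᵐ x ∂(volume : Measure (EuclideanSpace ℝ (Fin N))), Tendsto (fun n => φ n x) atTop (𝓝 (u x))

namespace IsSobolevLimit

variable {P : ENNReal} {Ω U : Set (EuclideanSpace ℝ (Fin N))}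
  {u : EuclideanSpace ℝ (Fin N) → ℝ} {H : EuclideanSpace ℝ (Fin N) → EuclideanSpace ℝ (Fin N)}

theorem ae_eq_zero (h : IsSobolevLimit P Ω u H) :
    ∀ᵐ x ∂(volume : Measure (EuclideanSpace ℝ (Fin N))), x ∉ Ω → u x = 0 := by
  obtain ⟨φ, hφ, -, -, hae⟩ := h.exists_seq
  filter_upwards [hae] with x hx hxΩ
  refine tendsto_nhds_unique hx ?_
  simp [fun n => (hφ n).eq_zero_of_notMem hxΩ]

/-- Integration by parts for test functions passes to the limit. As `U` is arbitrary, the same `H`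
serves on `Ω` and on the whole space. -/
theorem hasWeakGradientOn (hP : 1 ≤ P) (h : IsSobolevLimit P Ω u H) :
    HasWeakGradientOn U u H where
  locallyIntegrable := (h.memLp.locallyIntegrable hP).locallyIntegrableOn U
  locallyIntegrable_grad := (h.memLp_grad.locallyIntegrable hP).locallyIntegrableOn U
  integral_eq := by
    intro ψ hψ i
    rw [setIntegral_eq_integral_of_forall_compl_eq_zero
      (fun x hx => by simp [hψ.gradient_eq_zero hx]),
      setIntegral_eq_integral_of_forall_compl_eq_zero
      (fun x hx => by simp [hψ.eq_zero_of_notMem hx])]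
    obtain ⟨φ, hφ, hu, hH, -⟩ := h.exists_seq
    have : P.HolderConjugate P.conjExponent := ENNReal.HolderConjugate.conjExponent hP
    have hψi : MemLp (fun x => gradient ψ x i) P.conjExponent volume :=
      (hψ.continuous_gradient_apply i).memLp_of_hasCompactSupport
        (hψ.hasCompactSupport_gradient_apply i)
    have h1 := tendsto_integral_mul_of_tendsto_eLpNorm (fun n => (hφ n).memLp P) h.memLp hψi hu
    have hHi : MemLp (fun x => H x i) P volume :=
      h.memLp_grad.of_le ((EuclideanSpace.proj (𝕜 := ℝ) i).continuous.comp_aestronglyMeasurable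
        h.memLp_grad.1) (Eventually.of_forall fun x => PiLp.norm_apply_le (H x) i)
    have h2 := tendsto_integral_mul_of_tendsto_eLpNorm (f := fun n x => gradient (φ n) x i)
      (fun n => ((hφ n).continuous_gradient_apply i).memLp_of_hasCompactSupport
        ((hφ n).hasCompactSupport_gradient_apply i)) hHi (hψ.memLp P.conjExponent) ?_
    · refine tendsto_nhds_unique h1 ?_
      simp only [fun n => (hφ n).integral_mul_gradient hψ i]
      exact h2.neg
    · refine tendsto_of_tendsto_of_tendsto_of_le_of_le tendsto_const_nhds hH (fun _ => zero_le) ?_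
      intro n
      exact eLpNorm_mono fun x => PiLp.norm_apply_le (gradient (φ n) x - H x) i

theorem memW1p {p : ℝ} (hp : 1 ≤ p) (h : IsSobolevLimit (ENNReal.ofReal p) Ω u H) :
    MemW1p p U u :=
  ⟨h.memLp.restrict U, H, h.hasWeakGradientOn (by simpa using hp), h.memLp_grad.restrict U⟩

theorem memX {p : ℝ} (hp : 1 ≤ p) (h : IsSobolevLimit (ENNReal.ofReal p) Ω u H) :
    MemX p Ω u where
  memW1p := h.memW1p hp
  ae_eq_zero := h.ae_eq_zero
  memW1pZero := by
    refine ⟨h.memLp.restrict Ω, H, h.hasWeakGradientOn (by simpa using hp),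
      h.memLp_grad.restrict Ω, fun ε hε => ?_⟩
    obtain ⟨φ, hφ, hu, hH, -⟩ := h.exists_seq
    have hlim := hu.add hH
    rw [add_zero] at hlim
    obtain ⟨n, hn⟩ := (hlim.eventually_lt_const hε).exists
    refine ⟨φ n, hφ n, lt_of_le_of_lt (add_le_add ?_ ?_) hn⟩
    · refine (eLpNorm_mono_measure _ Measure.restrict_le_self).trans (eLpNorm_mono fun x => ?_)
      rw [norm_sub_rev]
    · refine (eLpNorm_mono_measure _ Measure.restrict_le_self).trans (eLpNorm_mono fun x => ?_)
      rw [norm_sub_rev]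

end IsSobolevLimit

/-- Test functions in `Ω` vanish with their gradients off `Ω`, so approximation in `L^p(Ω)` becomes
approximation in `L^p(ℝ^N)` once the gradient is extended by zero. A subsequence converges almost
everywhere. -/
theorem MemX.exists_isSobolevLimit {p : ℝ} (hp : 1 ≤ p) {Ω : Set (EuclideanSpace ℝ (Fin N))}
    (hΩ : IsOpen Ω) {u : EuclideanSpace ℝ (Fin N) → ℝ} (h : MemX p Ω u) :
    ∃ H, IsSobolevLimit (ENNReal.ofReal p) Ω u H := by
  obtain ⟨hu, G, -, hG, happ⟩ := h.memW1pZero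
  have huv : u =ᵐ[volume] Ω.indicator u := by
    filter_upwards [h.ae_eq_zero] with x hx
    by_cases hxΩ : x ∈ Ω <;> simp [hxΩ, hx]
  have hu' : MemLp u (ENNReal.ofReal p) volume :=
    (memLp_congr_ae huv).2 ((memLp_indicator_iff_restrict hΩ.measurableSet).2 hu)
  have hG' : MemLp (Ω.indicator G) (ENNReal.ofReal p) volume :=
    (memLp_indicator_iff_restrict hΩ.measurableSet).2 hG
  have hpos : ∀ n : ℕ, (0 : ENNReal) < ((n : ENNReal) + 1)⁻¹ := fun n => by simp
  choose φ hφ hlt using fun n : ℕ => happ _ (hpos n)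
  have hinv : Tendsto (fun n : ℕ => ((n : ENNReal) + 1)⁻¹) atTop (𝓝 0) := by
    have := (tendsto_add_atTop_iff_nat 1).2 ENNReal.tendsto_inv_nat_nhds_zero
    simpa using this
  have h1 : Tendsto (fun n => eLpNorm (fun x => φ n x - u x) (ENNReal.ofReal p) volume)
      atTop (𝓝 0) := by
    refine tendsto_of_tendsto_of_tendsto_of_le_of_le tendsto_const_nhds hinv (fun _ => zero_le) ?_
    intro n
    refine le_trans (le_of_eq ?_) (le_trans le_self_add (hlt n).le)
    rw [← eLpNorm_indicator_eq_eLpNorm_restrict hΩ.measurableSet]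
    refine eLpNorm_congr_norm_ae ?_
    filter_upwards [h.ae_eq_zero] with x hx
    by_cases hxΩ : x ∈ Ω
    · simp [hxΩ, abs_sub_comm]
    · simp [hxΩ, hx, (hφ n).eq_zero_of_notMem hxΩ]
  have h2 : Tendsto (fun n => eLpNorm (fun x => gradient (φ n) x - Ω.indicator G x)
      (ENNReal.ofReal p) volume) atTop (𝓝 0) := by
    refine tendsto_of_tendsto_of_tendsto_of_le_of_le tendsto_const_nhds hinv (fun _ => zero_le) ?_
    intro n
    refine le_trans (le_of_eq ?_) (le_trans le_add_self (hlt n).le)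
    rw [← eLpNorm_indicator_eq_eLpNorm_restrict hΩ.measurableSet]
    refine eLpNorm_congr_norm_ae (Eventually.of_forall fun x => ?_)
    by_cases hxΩ : x ∈ Ω
    · simp [hxΩ, norm_sub_rev]
    · simp [hxΩ, (hφ n).gradient_eq_zero hxΩ]
  obtain ⟨ns, hns, hae⟩ := (tendstoInMeasure_of_tendsto_eLpNorm (p := ENNReal.ofReal p)
    (by simp; linarith)
    (fun n => ((hφ n).memLp 1).1) hu'.1 h1).exists_seq_tendsto_ae
  exact ⟨Ω.indicator G, hu', hG', fun n => φ (ns n), fun n => hφ _, h1.comp hns.tendsto_atTop,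
    h2.comp hns.tendsto_atTop, hae⟩

theorem tendsto_eLpNorm_of_dominated {α E : Type*} [MeasurableSpace α] {μ : Measure α}
    [NormedAddCommGroup E] {P : ENNReal} (hP0 : P ≠ 0) (hP : P ≠ ⊤) {f : ℕ → α → E} {b : α → E}
    (hf : ∀ n, AEStronglyMeasurable (f n) μ) (hb : MemLp b P μ)
    (hfb : ∀ n, ∀ᵐ x ∂μ, ‖f n x‖ ≤ ‖b x‖)
    (hlim : ∀ᵐ x ∂μ, Tendsto (fun n => f n x) atTop (𝓝 0)) :
    Tendsto (fun n => eLpNorm (f n) P μ) atTop (𝓝 0) := by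
  have hpos : 0 < P.toReal := ENNReal.toReal_pos hP0 hP
  have h1 : Tendsto (fun n => ∫⁻ x, ‖f n x‖ₑ ^ P.toReal ∂μ) atTop (𝓝 (∫⁻ _, 0 ∂μ)) := by
    refine tendsto_lintegral_of_dominated_convergence' (fun x => ‖b x‖ₑ ^ P.toReal)
      (fun n => (hf n).enorm.pow_const _) (fun n => ?_) ?_ ?_
    · filter_upwards [hfb n] with x hx
      gcongr
      exact enorm_le_iff_norm_le.2 hx
    · exact (lintegral_rpow_enorm_lt_top_of_eLpNorm_lt_top hP0 hP hb.2).ne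
    · filter_upwards [hlim] with x hx
      have := ((ENNReal.continuous_rpow_const (y := P.toReal)).tendsto _).comp hx.enorm
      simpa [hpos, Function.comp_def] using this
  simp_rw [eLpNorm_eq_lintegral_rpow_enorm_toReal hP0 hP]
  have := ((ENNReal.continuous_rpow_const (y := 1 / P.toReal)).tendsto _).comp h1
  simpa [hpos, Function.comp_def] using this

namespace IsSobolevLimit

variable {P : ENNReal} {Ω U : Set (EuclideanSpace ℝ (Fin N))}
  {u : EuclideanSpace ℝ (Fin N) → ℝ} {H : EuclideanSpace ℝ (Fin N) → EuclideanSpace ℝ (Fin N)}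

/-- Smoothness of `F` and `F 0 = 0` keep `F ∘ φ n` a test function. The gradient error splits as
`F'(φ n)(∇φ n - H) + (F'(φ n) - F'(u)) H`: the first term is small because `|F'| ≤ 1`, the second by
dominated convergence with majorant `2|H|`. -/
theorem comp (hP1 : 1 ≤ P) (hP : P ≠ ⊤) (h : IsSobolevLimit P Ω u H) {F : ℝ → ℝ}
    (hF : ContDiff ℝ ∞ F) (hF0 : F 0 = 0) (hF' : ∀ t, ‖deriv F t‖ ≤ 1) :
    IsSobolevLimit P Ω (F ∘ u) (fun x => deriv F (u x) • H x) := by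
  have hlip : ∀ a b, ‖F a - F b‖ ≤ ‖a - b‖ := fun a b => by
    have := Convex.norm_image_sub_le_of_norm_deriv_le (𝕜 := ℝ) (f := F) (C := 1) (s := univ)
      (fun x _ => (hF.differentiable (by simp)) x) (fun x _ => hF' x) convex_univ (mem_univ b)
      (mem_univ a)
    simpa using this
  have hFc : Continuous F := hF.continuous
  have hF'c : Continuous (deriv F) := hF.continuous_deriv (by simp)
  have hum : AEStronglyMeasurable u volume := h.memLp.1
  have hP0 : P ≠ 0 := (zero_lt_one.trans_le hP1).ne'
  have hmeas : AEStronglyMeasurable (fun x => deriv F (u x) • H x) volume :=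
    (hF'c.comp_aestronglyMeasurable hum).smul h.memLp_grad.1
  have hle1 : ∀ (t : ℝ) (v : EuclideanSpace ℝ (Fin N)), ‖deriv F t • v‖ ≤ ‖v‖ := fun t v => by
    rw [norm_smul]
    exact mul_le_of_le_one_left (norm_nonneg _) (hF' t)
  refine ⟨h.memLp.of_le (hFc.comp_aestronglyMeasurable hum)
    (Eventually.of_forall fun x => by simpa [hF0] using hlip (u x) 0),
    h.memLp_grad.of_le hmeas (Eventually.of_forall fun x => hle1 _ _), ?_⟩
  obtain ⟨φ, hφ, hu, hH, hae⟩ := h.exists_seq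
  refine ⟨fun n => F ∘ φ n, fun n => (hφ n).comp hF hF0, ?_, ?_, ?_⟩
  · refine tendsto_of_tendsto_of_tendsto_of_le_of_le tendsto_const_nhds hu (fun _ => zero_le) ?_
    exact fun n => eLpNorm_mono fun x => hlip _ _
  · have hdiffm : ∀ n, AEStronglyMeasurable
        (fun x => (deriv F (φ n x) - deriv F (u x)) • H x) volume := fun n =>
      ((hF'c.comp (hφ n).continuous).aestronglyMeasurable.sub
        (hF'c.comp_aestronglyMeasurable hum)).smul h.memLp_grad.1
    have h2 : Tendsto (fun n => eLpNorm (fun x => (deriv F (φ n x) - deriv F (u x)) • H x) P volume)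
        atTop (𝓝 0) := by
      refine tendsto_eLpNorm_of_dominated hP0 hP hdiffm (h.memLp_grad.const_smul (2 : ℝ))
        (fun n => Eventually.of_forall fun x => ?_) ?_
      · simp only [Pi.smul_apply, norm_smul]
        gcongr
        refine (norm_sub_le _ _).trans ?_
        have h1 := hF' (φ n x)
        have h2 := hF' (u x)
        simp only [Real.norm_ofNat]
        linarith
      · filter_upwards [hae] with x hx
        have h3 := (((hF'c.tendsto (u x)).comp hx).sub_const (deriv F (u x))).smul_const (H x)
        simpa using h3
    have h3 := hH.add h2
    rw [add_zero] at h3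
    refine tendsto_of_tendsto_of_tendsto_of_le_of_le tendsto_const_nhds h3 (fun _ => zero_le) ?_
    intro n
    have hgm : AEStronglyMeasurable (fun x => deriv F (φ n x) • (gradient (φ n) x - H x)) volume :=
      (hF'c.comp (hφ n).continuous).aestronglyMeasurable.smul
        (((hφ n).memLp_gradient 1).1.sub h.memLp_grad.1)
    have heq : (fun x => gradient (F ∘ φ n) x - deriv F (u x) • H x)
        = (fun x => deriv F (φ n x) • (gradient (φ n) x - H x)) +
          fun x => (deriv F (φ n x) - deriv F (u x)) • H x := by
      funext x
      simp only [(hφ n).gradient_comp hF, Pi.add_apply]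
      module
    simp only [heq]
    refine (eLpNorm_add_le hgm (hdiffm n) hP1).trans ?_
    gcongr
    exact eLpNorm_mono fun x => hle1 _ _
  · filter_upwards [hae] with x hx
    exact (hFc.tendsto _).comp hx

end IsSobolevLimit

/-! ### Sobolev inequality and identification of the weak gradient. -/

/-- The Gagliardo–Nirenberg–Sobolev inequality for test functions survives in the limit by Fatou's
lemma. The constant does not depend on `Ω`. -/
theorem exists_sobolev_const {p r : ℝ} (hp : 1 ≤ p) (hN : 0 < N)
    (hr : r⁻¹ = p⁻¹ - (N : ℝ)⁻¹) (hr0 : 0 ≤ r) :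
    ∃ C : NNReal, ∀ (Ω : Set (EuclideanSpace ℝ (Fin N))) (u : EuclideanSpace ℝ (Fin N) → ℝ)
      (H : EuclideanSpace ℝ (Fin N) → EuclideanSpace ℝ (Fin N)),
      IsSobolevLimit (ENNReal.ofReal p) Ω u H →
        eLpNorm u (ENNReal.ofReal r) volume ≤ C * eLpNorm H (ENNReal.ofReal p) volume := by
  refine ⟨eLpNormLESNormFDerivOfEqInnerConst (volume : Measure (EuclideanSpace ℝ (Fin N)))
    (p.toNNReal : ℝ), fun Ω u H h => ?_⟩
  obtain ⟨φ, hφ, -, hH, hae⟩ := h.exists_seq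
  have hP1 : (1 : ENNReal) ≤ ENNReal.ofReal p := by simpa using hp
  set S := eLpNormLESNormFDerivOfEqInnerConst (volume : Measure (EuclideanSpace ℝ (Fin N)))
    (p.toNNReal : ℝ)
  have key : ∀ n, eLpNorm (φ n) (ENNReal.ofReal r) volume ≤
      S * (eLpNorm (fun x => gradient (φ n) x - H x) (ENNReal.ofReal p) volume +
        eLpNorm H (ENNReal.ofReal p) volume) := by
    intro n
    have h1 := eLpNorm_le_eLpNorm_fderiv_of_eq_inner
      (volume : Measure (EuclideanSpace ℝ (Fin N))) ((hφ n).smooth.of_le (by simp)) (hφ n).compact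
      (p := p.toNNReal) (p' := r.toNNReal) (by simpa using hp) (by simpa using hN)
      (by simp [hr0, hr, zero_le_one.trans hp])
    refine h1.trans ?_
    gcongr
    have h2 : eLpNorm (fderiv ℝ (φ n)) (ENNReal.ofReal p) volume
        = eLpNorm (gradient (φ n)) (ENNReal.ofReal p) volume :=
      eLpNorm_congr_norm_ae (Eventually.of_forall fun x => (norm_gradient _ _).symm)
    change eLpNorm (fderiv ℝ (φ n)) (ENNReal.ofReal p) volume ≤ _
    rw [h2]
    have h3 := eLpNorm_add_le (((hφ n).memLp_gradient (ENNReal.ofReal p)).1.sub h.memLp_grad.1)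
      h.memLp_grad.1 hP1
    rw [sub_add_cancel] at h3
    exact h3
  refine (Lp.eLpNorm_lim_le_liminf_eLpNorm (fun n => ((hφ n).memLp 1).1) u hae).trans ?_
  have hlim : Tendsto (fun n => (S : ENNReal) *
      (eLpNorm (fun x => gradient (φ n) x - H x) (ENNReal.ofReal p) volume +
        eLpNorm H (ENNReal.ofReal p) volume)) atTop
      (𝓝 (S * eLpNorm H (ENNReal.ofReal p) volume)) := by
    have := ENNReal.Tendsto.const_mul (a := (S : ENNReal)) (hH.add_const
      (eLpNorm H (ENNReal.ofReal p) volume)) (Or.inr ENNReal.coe_ne_top)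
    simpa using this
  rw [← hlim.liminf_eq]
  exact liminf_le_liminf (Eventually.of_forall key)

/-- Since `weakGradient` is an arbitrary choice, this uniqueness is what lets it be replaced by the
explicit gradient of a Sobolev limit. -/
theorem HasWeakGradientOn.ae_eq {u : EuclideanSpace ℝ (Fin N) → ℝ}
    {G H : EuclideanSpace ℝ (Fin N) → EuclideanSpace ℝ (Fin N)}
    (hG : HasWeakGradientOn univ u G) (hH : HasWeakGradientOn univ u H) : G =ᵐ[volume] H := by
  have hGl := locallyIntegrableOn_univ.1 hG.locallyIntegrable_grad
  have hHl := locallyIntegrableOn_univ.1 hH.locallyIntegrable_grad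
  have hcoord : ∀ i : Fin N, ∀ᵐ x ∂(volume : Measure (EuclideanSpace ℝ (Fin N))),
      G x i - H x i = 0 := by
    intro i
    have hproj : ∀ {K : EuclideanSpace ℝ (Fin N) → EuclideanSpace ℝ (Fin N)},
        LocallyIntegrable K volume → LocallyIntegrable (fun x => K x i) volume := fun hK =>
      hK.mono ((EuclideanSpace.proj (𝕜 := ℝ) i).continuous.comp_aestronglyMeasurable
        hK.aestronglyMeasurable) (Eventually.of_forall fun x => PiLp.norm_apply_le _ i)
    refine ae_eq_zero_of_integral_contDiff_smul_eq_zero ((hproj hGl).sub (hproj hHl)) ?_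
    intro φ hφ hc
    have hφt : IsTestFunction univ φ := ⟨hφ, hc, subset_univ _⟩
    have h1 := hG.integral_eq φ hφt i
    rw [hH.integral_eq φ hφt i, neg_inj] at h1
    simp only [setIntegral_univ] at h1
    simp only [smul_eq_mul, mul_sub]
    have hint : ∀ {K : EuclideanSpace ℝ (Fin N) → EuclideanSpace ℝ (Fin N)},
        LocallyIntegrable K volume → Integrable (fun x => φ x * K x i) volume := fun hK =>
      (hproj hK).integrable_smul_left_of_hasCompactSupport hφ.continuous hc
    rw [integral_sub (hint hGl) (hint hHl)]
    simp only [mul_comm (φ _)]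
    rw [h1, sub_self]
  filter_upwards [ae_all_iff.2 hcoord] with x hx
  ext i
  exact sub_eq_zero.1 (hx i)

theorem IsSobolevLimit.weakGradient_ae_eq {P : ENNReal} (hP : 1 ≤ P)
    {Ω : Set (EuclideanSpace ℝ (Fin N))} {u : EuclideanSpace ℝ (Fin N) → ℝ}
    {H : EuclideanSpace ℝ (Fin N) → EuclideanSpace ℝ (Fin N)} (h : IsSobolevLimit P Ω u H) :
    weakGradient u =ᵐ[volume] H :=
  (Classical.epsilon_spec (p := fun G => HasWeakGradientOn univ u G)
    ⟨H, h.hasWeakGradientOn hP⟩).ae_eq (h.hasWeakGradientOn hP)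

/-! ### Smooth truncation and fast geometric convergence. -/

/-- A smooth substitute for the truncation `sign(t) (|t| - k)⁺`: integrate an even transition rising
from `0` on `|t| ≤ k` to `1` on `|t| ≥ m`. Removing the kink costs a second level `m`. -/
theorem exists_smooth_truncation {k m : ℝ} (hk : 0 < k) (hkm : k < m) :
    ∃ F : ℝ → ℝ, ContDiff ℝ ∞ F ∧ (∀ t, 0 ≤ deriv F t) ∧ (∀ t, deriv F t ≤ 1) ∧
      (∀ t, |t| ≤ k → F t = 0) ∧ deriv F 0 = 0 ∧ ∀ t, |t| ≤ |F t| + m := by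
  -- Using `t ^ 2` instead of `|t|` makes `ρ` smooth and even at once.
  set ρ : ℝ → ℝ := fun t => Real.smoothTransition ((t ^ 2 - k ^ 2) / (m ^ 2 - k ^ 2)) with hρdef
  have hden : 0 < m ^ 2 - k ^ 2 := by nlinarith
  have hρ : ContDiff ℝ ∞ ρ := Real.smoothTransition.contDiff.comp (by fun_prop)
  have hρc : Continuous ρ := hρ.continuous
  have hρ0 : ∀ t, |t| ≤ k → ρ t = 0 := fun t ht => by
    refine Real.smoothTransition.zero_of_nonpos (div_nonpos_of_nonpos_of_nonneg ?_ hden.le)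
    have := sq_le_sq' (by linarith [(abs_le.1 ht).1]) (abs_le.1 ht).2
    linarith
  have hρ1 : ∀ t, m ≤ |t| → ρ t = 1 := fun t ht => by
    refine Real.smoothTransition.one_of_one_le ((one_le_div hden).2 ?_)
    have h1 : m ^ 2 ≤ |t| ^ 2 := by gcongr; linarith
    rw [sq_abs] at h1
    linarith
  have hnonneg : ∀ t, 0 ≤ ρ t := fun t => Real.smoothTransition.nonneg _
  have heven : ∀ t, ρ (-t) = ρ t := fun t => by simp [hρdef]
  set F : ℝ → ℝ := fun t => ∫ x in (0 : ℝ)..t, ρ x with hF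
  have hderiv : ∀ t, HasDerivAt F (ρ t) t := fun t =>
    intervalIntegral.integral_hasDerivAt_right (hρc.intervalIntegrable _ _)
      (hρc.stronglyMeasurableAtFilter _ _) hρc.continuousAt
  have hdF : deriv F = ρ := funext fun t => (hderiv t).deriv
  have hzero : ∀ t, |t| ≤ k → F t = 0 := fun t ht => by
    rw [hF]
    simp only
    rw [intervalIntegral.integral_congr (g := fun _ => (0 : ℝ)), intervalIntegral.integral_zero]
    intro x hx
    refine hρ0 x (le_trans ?_ ht)
    rcases le_total 0 t with h0 | h0
    · rw [uIcc_of_le h0] at hx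
      rw [abs_of_nonneg hx.1, abs_of_nonneg h0]
      exact hx.2
    · rw [uIcc_of_ge h0] at hx
      rw [abs_of_nonpos hx.2, abs_of_nonpos h0]
      linarith [hx.1]
  have hodd : ∀ t, F (-t) = - F t := fun t => by
    have := intervalIntegral.integral_comp_neg (a := 0) (b := t) ρ
    simp only [heven, neg_zero] at this
    rw [hF]
    simp only
    rw [intervalIntegral.integral_symm, ← this]
  have hpos : ∀ t, 0 ≤ t → t ≤ |F t| + m := fun t ht => by
    rcases le_total t m with htm | htm
    · exact htm.trans (by linarith [abs_nonneg (F t)])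
    · have h1 : F t = (∫ x in (0 : ℝ)..m, ρ x) + ∫ x in m..t, ρ x :=
        (intervalIntegral.integral_add_adjacent_intervals (hρc.intervalIntegrable _ _)
          (hρc.intervalIntegrable _ _)).symm
      have h2 : ∫ x in m..t, ρ x = t - m := by
        rw [intervalIntegral.integral_congr (g := fun _ => (1 : ℝ))]
        · simp
        · intro x hx
          rw [uIcc_of_le htm] at hx
          exact hρ1 x (hx.1.trans (le_abs_self x))
      have h3 : 0 ≤ ∫ x in (0 : ℝ)..m, ρ x :=
        intervalIntegral.integral_nonneg (by linarith) fun x _ => hnonneg x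
      have := le_abs_self (F t)
      linarith
  refine ⟨F, contDiff_infty_iff_deriv.2 ⟨fun t => (hderiv t).differentiableAt, hdF ▸ hρ⟩,
    fun t => hdF ▸ hnonneg t, fun t => hdF ▸ Real.smoothTransition.le_one _, hzero,
    hdF ▸ hρ0 0 (by simpa using hk.le), fun t => ?_⟩
  rcases le_total 0 t with h0 | h0
  · rw [abs_of_nonneg h0]
    exact hpos t h0
  · have := hpos (-t) (by linarith)
    rwa [hodd, abs_neg, ← abs_of_nonpos h0] at this

theorem exists_threshold_tendsto_zero {C B β : ℝ} (hC : 0 < C) (hB : 1 < B) (hβ : 1 < β) :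
    ∃ η : ℝ, 0 < η ∧ ∀ c : ℕ → ENNReal, c 0 ≤ ENNReal.ofReal η →
      (∀ n, c (n + 1) ≤ ENNReal.ofReal (C * B ^ n) * c n ^ β) → Tendsto c atTop (𝓝 0) := by
  have hB0 : 0 < B := by linarith
  have hβ1 : 0 < β - 1 := by linarith
  -- The bound `c n ≤ η ρ ^ n` is propagated by induction. This forces `B ρ^(β-1) = 1` and `C
  -- η^(β-1) = ρ`, which determine `ρ` and `η`.
  set ρ : ℝ := B ^ (-(1 / (β - 1))) with hρ
  have hρ0 : 0 < ρ := Real.rpow_pos_of_pos hB0 _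
  have hρ1 : ρ < 1 := Real.rpow_lt_one_of_one_lt_of_neg hB (by simpa using hβ1)
  have hBρ : B * ρ ^ (β - 1) = 1 := by
    rw [hρ, ← Real.rpow_mul hB0.le]
    field_simp
    rw [Real.rpow_neg_one, mul_inv_cancel₀ hB0.ne']
  set η : ℝ := (ρ / C) ^ (1 / (β - 1)) with hη
  have hη0 : 0 < η := Real.rpow_pos_of_pos (by positivity) _
  have hCη : C * η ^ (β - 1) = ρ := by
    rw [hη, ← Real.rpow_mul (by positivity), one_div_mul_cancel hβ1.ne', Real.rpow_one]
    field_simp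
  refine ⟨η, hη0, fun c hc0 hc => ?_⟩
  have key : ∀ n, c n ≤ ENNReal.ofReal (η * ρ ^ n) := by
    intro n
    induction n with
    | zero => simpa using hc0
    | succ n ih =>
      refine (hc n).trans ?_
      have hx : 0 < η * ρ ^ n := by positivity
      calc ENNReal.ofReal (C * B ^ n) * c n ^ β
          ≤ ENNReal.ofReal (C * B ^ n) * ENNReal.ofReal (η * ρ ^ n) ^ β := by gcongr
        _ = ENNReal.ofReal (C * B ^ n * (η * ρ ^ n) ^ β) := by
          rw [ENNReal.ofReal_rpow_of_pos hx, ← ENNReal.ofReal_mul (by positivity)]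
        _ = ENNReal.ofReal (η * ρ ^ (n + 1)) := by
          congr 1
          have h1 : (η * ρ ^ n) ^ β = (η * ρ ^ n) * (η ^ (β - 1) * (ρ ^ (β - 1)) ^ n) := by
            have : β = 1 + (β - 1) := by ring
            rw [this, Real.rpow_add hx, Real.rpow_one, ← this,
              Real.mul_rpow hη0.le (by positivity), ← Real.rpow_natCast_mul hρ0.le,
              mul_comm (n : ℝ), Real.rpow_mul_natCast hρ0.le]
          rw [h1]
          calc C * B ^ n * (η * ρ ^ n * (η ^ (β - 1) * (ρ ^ (β - 1)) ^ n))
              = η * ρ ^ n * (C * η ^ (β - 1)) * (B * ρ ^ (β - 1)) ^ n := by rw [mul_pow]; ring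
            _ = η * ρ ^ (n + 1) := by rw [hCη, hBρ]; ring
  refine tendsto_of_tendsto_of_tendsto_of_le_of_le tendsto_const_nhds ?_ (fun _ => zero_le) key
  have h1 := ((tendsto_pow_atTop_nhds_zero_of_lt_one hρ0.le hρ1).const_mul η)
  have h2 := (ENNReal.continuous_ofReal.tendsto _).comp h1
  simpa [Function.comp_def] using h2

/-! ### Energy and level set estimates. -/

theorem IsWeakSolution.lintegral_grad_le {s p : ℝ} (hp : 1 < p)
    {Ω : Set (EuclideanSpace ℝ (Fin N))} (hΩ : IsOpen Ω)
    {V g u : EuclideanSpace ℝ (Fin N) → ℝ} {lam : ℝ} (hlam : 0 ≤ lam)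
    (hV0 : ∀ᵐ x ∂(volume.restrict Ω), 0 ≤ V x) (hu : IsWeakSolution s p Ω V g lam u)
    {H : EuclideanSpace ℝ (Fin N) → EuclideanSpace ℝ (Fin N)}
    (h : IsSobolevLimit (ENNReal.ofReal p) Ω u H) {F : ℝ → ℝ} (hF : ContDiff ℝ ∞ F)
    (hF0 : F 0 = 0) (hd0 : ∀ t, 0 ≤ deriv F t) (hd1 : ∀ t, deriv F t ≤ 1) (hdz : deriv F 0 = 0) :
    ∫⁻ x, ‖deriv F (u x) • H x‖ₑ ^ p ≤
      ENNReal.ofReal lam * ∫⁻ x in Ω, ‖g x‖ₑ * (‖u x‖ₑ ^ (p - 1) * ‖F (u x)‖ₑ) := by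
  have hp0 : 0 < p := by linarith
  have hP1 : (1 : ENNReal) ≤ ENNReal.ofReal p := by simpa using hp.le
  have hw := h.comp hP1 ENNReal.ofReal_ne_top hF hF0
    (fun t => by rw [Real.norm_of_nonneg (hd0 t)]; exact hd1 t)
  have hmono : Monotone F := monotone_of_deriv_nonneg (hF.differentiable (by simp)) hd0
  have hsign : ∀ t, 0 ≤ t * F t := fun t => by
    rcases le_total 0 t with ht | ht
    · exact mul_nonneg ht (hF0 ▸ hmono ht)
    · exact mul_nonneg_of_nonpos_of_nonpos ht (hF0 ▸ hmono ht)
  have heq := hu.2 _ (hw.memX hp.le)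
  -- The factors `u x - u y` and `F (u x) - F (u y)` have the same sign. Nonnegativity of the
  -- integral needs no integrability, so convergence of the double integral is not at issue.
  have hnonloc : 0 ≤ nonlocalForm s p u (F ∘ u) := by
    refine integral_nonneg fun z => div_nonneg ?_ (Real.rpow_nonneg (norm_nonneg _) _)
    rw [mul_assoc]
    refine mul_nonneg (Real.rpow_nonneg (abs_nonneg _) _) ?_
    rcases le_total (u z.1) (u z.2) with hz | hz
    · exact mul_nonneg_of_nonpos_of_nonpos (by linarith) (by simpa using hmono hz)
    · exact mul_nonneg (by linarith) (by simpa using hmono hz)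
  have hpot : 0 ≤ ∫ x in Ω, V x * |u x| ^ (p - 2) * u x * (F ∘ u) x := by
    refine integral_nonneg_of_ae ?_
    filter_upwards [hV0] with x hx
    rw [mul_assoc]
    exact mul_nonneg (mul_nonneg hx (Real.rpow_nonneg (abs_nonneg _) _)) (hsign _)
  have hloc : localForm p Ω u (F ∘ u) = ∫ x in Ω, deriv F (u x) * ‖H x‖ ^ p := by
    refine integral_congr_ae (ae_restrict_of_ae ?_)
    filter_upwards [h.weakGradient_ae_eq hP1, hw.weakGradient_ae_eq hP1] with x hx hx'
    rw [hx, hx', inner_smul_right, real_inner_self_eq_norm_sq]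
    -- The power `p - 2` may be negative, so points with `H x = 0` are treated apart; both sides
    -- vanish there.
    rcases (norm_nonneg (H x)).eq_or_lt with h0 | h0
    · simp [← h0, hp0.ne']
    · have : ‖H x‖ ^ p = ‖H x‖ ^ (p - 2) * ‖H x‖ ^ 2 := by
        rw [← Real.rpow_natCast, ← Real.rpow_add h0]
        simp
      rw [this]
      ring
  have hint : Integrable (fun x => deriv F (u x) * ‖H x‖ ^ p) volume := by
    have h1 := h.memLp_grad.integrable_norm_rpow (by simpa using hp0) ENNReal.ofReal_ne_top
    rw [ENNReal.toReal_ofReal hp0.le] at h1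
    refine h1.mono (((hF.continuous_deriv (by simp)).comp_aestronglyMeasurable h.memLp.1).mul h1.1)
      (Eventually.of_forall fun x => ?_)
    rw [norm_mul, Real.norm_of_nonneg (hd0 _)]
    exact mul_le_of_le_one_left (norm_nonneg _) (hd1 _)
  have hle : localForm p Ω u (F ∘ u) ≤
      lam * ∫ x in Ω, g x * |u x| ^ (p - 2) * u x * (F ∘ u) x := by linarith
  calc ∫⁻ x, ‖deriv F (u x) • H x‖ₑ ^ p
      = ∫⁻ x in Ω, ‖deriv F (u x) • H x‖ₑ ^ p := by
        rw [← lintegral_indicator hΩ.measurableSet]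
        refine lintegral_congr_ae ?_
        -- Off `Ω`, `u = 0` almost everywhere, and `deriv F 0 = 0` kills the integrand.
        filter_upwards [h.ae_eq_zero] with x hx
        by_cases hxΩ : x ∈ Ω
        · simp [hxΩ]
        · simp [hxΩ, hx hxΩ, hdz, hp0]
    _ ≤ ∫⁻ x in Ω, ENNReal.ofReal (deriv F (u x) * ‖H x‖ ^ p) := by
        refine lintegral_mono fun x => ?_
        rw [← ofReal_norm, norm_smul, ENNReal.ofReal_rpow_of_nonneg (by positivity) hp0.le,
          Real.norm_of_nonneg (hd0 _), Real.mul_rpow (hd0 _) (norm_nonneg _)]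
        gcongr
        -- Since `0 ≤ F' ≤ 1` and `p > 1`, `F'^p ≤ F'`.
        exact Real.rpow_le_self_of_le_one (hd0 _) (hd1 _) hp.le
    _ = ENNReal.ofReal (localForm p Ω u (F ∘ u)) := by
        rw [hloc, ofReal_integral_eq_lintegral_ofReal hint.restrict]
        exact Eventually.of_forall fun x => mul_nonneg (hd0 _) (by positivity)
    _ ≤ ENNReal.ofReal (lam * ∫ x in Ω, g x * |u x| ^ (p - 2) * u x * (F ∘ u) x) :=
        ENNReal.ofReal_le_ofReal hle
    _ ≤ ENNReal.ofReal lam * ‖∫ x in Ω, g x * |u x| ^ (p - 2) * u x * (F ∘ u) x‖ₑ := by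
        rw [ENNReal.ofReal_mul hlam]
        gcongr
        exact Real.ofReal_le_enorm _
    _ ≤ ENNReal.ofReal lam * ∫⁻ x in Ω, ‖g x‖ₑ * (‖u x‖ₑ ^ (p - 1) * ‖F (u x)‖ₑ) := by
        gcongr
        refine (enorm_integral_le_lintegral_enorm _).trans (le_of_eq (lintegral_congr fun x => ?_))
        have h1 : ‖|u x| ^ (p - 2) * u x‖ₑ = ‖u x‖ₑ ^ (p - 1) := by
          rw [← ofReal_norm, ← ofReal_norm,
            ENNReal.ofReal_rpow_of_nonneg (norm_nonneg _) (by linarith), norm_mul,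
            Real.norm_of_nonneg (Real.rpow_nonneg (abs_nonneg _) _), Real.norm_eq_abs]
          rcases (abs_nonneg (u x)).eq_or_lt with h0 | h0
          · rw [← h0, Real.zero_rpow (by linarith : p - 1 ≠ 0), mul_zero]
          · rw [← Real.rpow_add_one h0.ne']
            ring_nf
        rw [mul_assoc (g x), enorm_mul, enorm_mul, h1, mul_assoc]
        rfl

theorem eLpNorm_ofReal_eq {α E : Type*} [MeasurableSpace α] {μ : Measure α} [NormedAddCommGroup E]
    {p : ℝ} (hp : 0 < p) (f : α → E) :
    eLpNorm f (ENNReal.ofReal p) μ = (∫⁻ x, ‖f x‖ₑ ^ p ∂μ) ^ (1 / p) := by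
  rw [eLpNorm_eq_lintegral_rpow_enorm_toReal (by simpa using hp) ENNReal.ofReal_ne_top,
    ENNReal.toReal_ofReal hp.le]

theorem eLpNorm_ofReal_rpow {α E : Type*} [MeasurableSpace α] {μ : Measure α}
    [NormedAddCommGroup E] {p : ℝ} (hp : 0 < p) (f : α → E) :
    eLpNorm f (ENNReal.ofReal p) μ ^ p = ∫⁻ x, ‖f x‖ₑ ^ p ∂μ := by
  rw [eLpNorm_ofReal_eq hp, ← ENNReal.rpow_mul, one_div_mul_cancel hp.ne', ENNReal.rpow_one]

theorem lintegral_enorm_mul_rpow_le {α : Type*} [MeasurableSpace α] {μ : Measure α}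
    {g w : α → ℝ} (hg : AEStronglyMeasurable g μ) (hw : AEStronglyMeasurable w μ)
    {p t r : ℝ} (hp : 0 < p) (hr : 0 < r) (ht : t.HolderConjugate (r / p)) :
    ∫⁻ x, ‖g x‖ₑ * ‖w x‖ₑ ^ p ∂μ ≤
      eLpNorm g (ENNReal.ofReal t) μ * eLpNorm w (ENNReal.ofReal r) μ ^ p := by
  refine (ENNReal.lintegral_mul_le_Lp_mul_Lq μ ht hg.enorm (hw.enorm.pow_const p)).trans
    (le_of_eq ?_)
  rw [eLpNorm_ofReal_eq ht.pos, eLpNorm_ofReal_eq hr, ← ENNReal.rpow_mul]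
  congr 2
  · refine lintegral_congr fun x => ?_
    rw [← ENNReal.rpow_mul, mul_div_cancel₀ _ hp.ne']
  · field_simp

/-- Energy, Sobolev and Hölder give `X ≤ M |A|^(p/N - 1/q) X + M m^p |A|^(1 - 1/q)` with `X =
‖F(u)‖_r^p` and `A = {k < |u|}`. The smallness assumption absorbs the first term, and Chebyshev's
inequality bounds `X` from below. -/
theorem IsWeakSolution.exists_level_set_estimate {s p q r : ℝ} (hp : 1 < p) (hN : 0 < N)
    (hq : (N : ℝ) / p < q) (hr0 : 0 < r) (hr : r⁻¹ = p⁻¹ - (N : ℝ)⁻¹) (hpN : p < N)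
    {Ω : Set (EuclideanSpace ℝ (Fin N))} (hΩ : IsOpen Ω)
    {V g u : EuclideanSpace ℝ (Fin N) → ℝ} {lam : ℝ} (hlam : 0 ≤ lam)
    (hV0 : ∀ᵐ x ∂(volume.restrict Ω), 0 ≤ V x)
    (hg : MemLp g (ENNReal.ofReal q) (volume.restrict Ω)) (hu : IsWeakSolution s p Ω V g lam u) :
    ∃ M : NNReal, ∀ k m h : ℝ, 0 < k → k < m → m < h →
      M * volume {x | k < ‖u x‖} ^ (p / N - 1 / q) ≤ 2⁻¹ →
      ENNReal.ofReal (h - m) ^ p * volume {x | h < ‖u x‖} ^ (p / r) ≤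
        2 * M * ENNReal.ofReal m ^ p * volume {x | k < ‖u x‖} ^ (1 - 1 / q) := by
  have hp0 : 0 < p := by linarith
  have hNR : (0 : ℝ) < N := by exact_mod_cast hN
  have hP1 : (1 : ENNReal) ≤ ENNReal.ofReal p := by simpa using hp.le
  have hNp : 1 < (N : ℝ) / p := (one_lt_div hp0).2 hpN
  obtain ⟨H, hH⟩ := hu.1.exists_isSobolevLimit hp.le hΩ
  obtain ⟨S, hS⟩ := exists_sobolev_const hp.le hN hr hr0.le
  set Γ := eLpNorm g (ENNReal.ofReal q) (volume.restrict Ω)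
  set M : ENNReal := S ^ p * ENNReal.ofReal lam * 2 ^ (p - 1) * Γ with hM
  have hMtop : M ≠ ⊤ := by
    refine ENNReal.mul_ne_top (ENNReal.mul_ne_top (ENNReal.mul_ne_top ?_ ENNReal.ofReal_ne_top) ?_)
      hg.2.ne
    · exact ENNReal.rpow_ne_top_of_nonneg hp0.le ENNReal.coe_ne_top
    · exact ENNReal.rpow_ne_top_of_nonneg (by linarith) (by simp)
  refine ⟨M.toNNReal, fun k m h hk hkm hmh hsmall => ?_⟩
  rw [ENNReal.coe_toNNReal hMtop] at hsmall ⊢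
  obtain ⟨F, hF, hd0, hd1, hFz, hdz, hFm⟩ := exists_smooth_truncation hk hkm
  have hF0 : F 0 = 0 := hFz 0 (by simpa using hk.le)
  have hw := hH.comp hP1 ENNReal.ofReal_ne_top hF hF0
    (fun t => by rw [Real.norm_of_nonneg (hd0 t)]; exact hd1 t)
  have henergy := hu.lintegral_grad_le hp hΩ hlam hV0 hH hF hF0 hd0 hd1 hdz
  have hum : AEStronglyMeasurable u volume := hH.memLp.1
  have hwm : AEStronglyMeasurable (F ∘ u) volume := hw.memLp.1
  set X := eLpNorm (F ∘ u) (ENNReal.ofReal r) volume ^ p with hX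
  have hXE : X ≤ S ^ p * ∫⁻ x, ‖deriv F (u x) • H x‖ₑ ^ p := by
    rw [← eLpNorm_ofReal_rpow hp0, ← ENNReal.mul_rpow_of_nonneg _ _ hp0.le]
    exact ENNReal.rpow_le_rpow (hS Ω _ _ hw) hp0.le
  -- Finiteness of `X` is what permits the later absorption.
  have hXtop : X ≠ ⊤ := by
    refine ENNReal.rpow_ne_top_of_nonneg hp0.le (ne_top_of_le_ne_top ?_ (hS Ω _ _ hw))
    exact ENNReal.mul_ne_top ENNReal.coe_ne_top hw.memLp_grad.2.ne
  set A := {x | k < ‖u x‖} with hA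
  have hAm : NullMeasurableSet A volume := 
    nullMeasurableSet_lt aemeasurable_const hum.norm.aemeasurable
  set ν := (volume.restrict Ω).restrict A with hν
  have hνle : ν ≤ volume.restrict Ω := Measure.restrict_le_self
  have hνvol : ν ≤ volume := hνle.trans Measure.restrict_le_self
  have hνA : ν univ ≤ volume A := by
    rw [hν, Measure.restrict_apply_univ]
    exact Measure.restrict_apply_le Ω A
  have hgν : AEStronglyMeasurable g ν := hg.1.mono_measure hνle
  have hwν : AEStronglyMeasurable (F ∘ u) ν := hwm.mono_measure hνvol
  have hgt : ∀ t : ℝ, 1 ≤ t → t ≤ q →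
      eLpNorm g (ENNReal.ofReal t) ν ≤ Γ * volume A ^ (1 / t - 1 / q) := fun t ht htq => by
    have h1 := eLpNorm_le_eLpNorm_mul_rpow_measure_univ (ENNReal.ofReal_le_ofReal htq) hgν
    rw [ENNReal.toReal_ofReal (by linarith), ENNReal.toReal_ofReal (by linarith)] at h1
    refine h1.trans ?_
    gcongr
    · exact eLpNorm_mono_measure _ hνle
    · exact sub_nonneg.2 (one_div_le_one_div_of_le (by linarith) htq)
  -- The Sobolev relation `1/r = 1/p - 1/N` says exactly that `N/p` and `r/p` are conjugate.
  have hconj : (N / p : ℝ).HolderConjugate (r / p) := by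
    refine Real.holderConjugate_iff.2 ⟨hNp, ?_⟩
    rw [inv_div, inv_div, div_eq_mul_inv p r, hr]
    field_simp
    ring
  have hmain : ∫⁻ x in Ω, ‖g x‖ₑ * (‖u x‖ₑ ^ (p - 1) * ‖F (u x)‖ₑ) ≤
      2 ^ (p - 1) * Γ * (volume A ^ (p / N - 1 / q) * X +
        ENNReal.ofReal m ^ p * volume A ^ (1 - 1 / q)) := by
    calc ∫⁻ x in Ω, ‖g x‖ₑ * (‖u x‖ₑ ^ (p - 1) * ‖F (u x)‖ₑ)
        = ∫⁻ x, ‖g x‖ₑ * (‖u x‖ₑ ^ (p - 1) * ‖F (u x)‖ₑ) ∂ν := by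
          rw [hν, ← lintegral_indicator₀ (hAm.mono_ac Measure.absolutelyContinuous_restrict)]
          refine lintegral_congr fun x => ?_
          by_cases hx : x ∈ A
          · simp [hx]
          · simp [hx, hFz (u x) (not_lt.1 hx)]
      _ ≤ ∫⁻ x, 2 ^ (p - 1) * (‖g x‖ₑ * ‖(F ∘ u) x‖ₑ ^ p + ‖g x‖ₑ * ENNReal.ofReal m ^ p) ∂ν := by
          refine lintegral_mono fun x => ?_
          set b := ‖F (u x)‖ₑ + ENNReal.ofReal m
          have hb : ‖u x‖ₑ ≤ b := by
            rw [← ofReal_norm]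
            refine (ENNReal.ofReal_le_ofReal (hFm (u x))).trans (ENNReal.ofReal_add_le.trans ?_)
            rw [← Real.norm_eq_abs, ofReal_norm]
          have h1 : ‖u x‖ₑ ^ (p - 1) * ‖F (u x)‖ₑ ≤ b ^ p := by
            have : b ^ p = b ^ (p - 1) * b := by
              conv_rhs => rw [← ENNReal.rpow_one b, ← ENNReal.rpow_mul, one_mul]
              rw [← ENNReal.rpow_add_of_nonneg _ _ (by linarith) zero_le_one, sub_add_cancel]
            rw [this]
            gcongr
            exact le_self_add
          refine (mul_le_mul_right (h1.trans
            (ENNReal.rpow_add_le_mul_rpow_add_rpow _ _ hp.le)) ‖g x‖ₑ).trans (le_of_eq ?_)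
          simp only [Function.comp_apply]
          ring
      _ = 2 ^ (p - 1) * (∫⁻ x, ‖g x‖ₑ * ‖(F ∘ u) x‖ₑ ^ p ∂ν +
            eLpNorm g (ENNReal.ofReal 1) ν * ENNReal.ofReal m ^ p) := by
          have hm : AEMeasurable (fun x => ‖g x‖ₑ * ‖(F ∘ u) x‖ₑ ^ p) ν :=
            hgν.enorm.mul (hwν.enorm.pow_const p)
          rw [lintegral_const_mul' _ _ (ENNReal.rpow_ne_top_of_nonneg (by linarith) (by simp)),
            lintegral_add_left' hm,
            lintegral_mul_const'' _ hgν.enorm, ENNReal.ofReal_one, eLpNorm_one_eq_lintegral_enorm]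
      _ ≤ 2 ^ (p - 1) * ((Γ * volume A ^ (1 / (N / p : ℝ) - 1 / q)) * X +
            (Γ * volume A ^ (1 / (1 : ℝ) - 1 / q)) * ENNReal.ofReal m ^ p) := by
          gcongr
          · refine (lintegral_enorm_mul_rpow_le hgν hwν hp0 hr0 hconj).trans ?_
            refine mul_le_mul' (hgt _ hNp.le hq.le) ?_
            exact ENNReal.rpow_le_rpow (eLpNorm_mono_measure _ hνvol) hp0.le
          · exact hgt 1 le_rfl (by linarith)
      _ = _ := by
          rw [one_div_div, div_one]
          ring
  have habs : X ≤ M * volume A ^ (p / N - 1 / q) * X +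
      M * ENNReal.ofReal m ^ p * volume A ^ (1 - 1 / q) := by
    calc X ≤ S ^ p * (ENNReal.ofReal lam * (2 ^ (p - 1) * Γ * (volume A ^ (p / N - 1 / q) * X +
        ENNReal.ofReal m ^ p * volume A ^ (1 - 1 / q)))) :=
          hXE.trans (mul_le_mul_right (henergy.trans (mul_le_mul_right hmain _)) _)
      _ = _ := by rw [hM]; ring
  have hX2 : X ≤ 2 * (M * ENNReal.ofReal m ^ p * volume A ^ (1 - 1 / q)) := by
    set Y := M * ENNReal.ofReal m ^ p * volume A ^ (1 - 1 / q)
    have h1 : X / 2 + X / 2 ≤ X / 2 + Y := by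
      rw [ENNReal.add_halves]
      refine habs.trans ?_
      gcongr
      rw [ENNReal.div_eq_inv_mul]
      gcongr
    have h2 := (ENNReal.add_le_add_iff_left (ENNReal.div_ne_top hXtop two_ne_zero)).1 h1
    rw [ENNReal.div_le_iff_le_mul (Or.inl two_ne_zero) (Or.inl ENNReal.ofNat_ne_top)] at h2
    rwa [mul_comm] at h2
  have hcheb : ENNReal.ofReal (h - m) ^ p * volume {x | h < ‖u x‖} ^ (p / r) ≤ X := by
    have h1 := mul_meas_ge_le_pow_eLpNorm' (p := ENNReal.ofReal r) volume (by simpa using hr0)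
      ENNReal.ofReal_ne_top hwm (ENNReal.ofReal (h - m))
    rw [ENNReal.toReal_ofReal hr0.le] at h1
    -- Where `|u| > h`, the bound `|u| ≤ |F(u)| + m` gives `|F(u)| ≥ h - m`.
    have h2 : volume {x | h < ‖u x‖} ≤ volume {x | ENNReal.ofReal (h - m) ≤ ‖(F ∘ u) x‖ₑ} := by
      refine measure_mono fun x hx => ?_
      simp only [mem_ofPred_eq, Real.norm_eq_abs] at hx ⊢
      rw [← ofReal_norm]
      refine ENNReal.ofReal_le_ofReal ?_
      have := hFm (u x)
      simp only [Function.comp_apply, Real.norm_eq_abs]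
      linarith
    have h3 := ENNReal.rpow_le_rpow ((mul_le_mul_right h2 _).trans h1)
      (div_pos hp0 hr0).le
    rwa [ENNReal.mul_rpow_of_nonneg _ _ (div_pos hp0 hr0).le, ← ENNReal.rpow_mul,
      ← ENNReal.rpow_mul, mul_div_cancel₀ _ hr0.ne'] at h3
  refine hcheb.trans (hX2.trans (le_of_eq ?_))
  ring

/-! ### De Giorgi iteration and conclusion. -/

theorem tendsto_measure_lt_norm_atTop {α E : Type*} [MeasurableSpace α] {μ : Measure α}
    [NormedAddCommGroup E] {P : ENNReal} (hP0 : P ≠ 0) (hP : P ≠ ⊤) {f : α → E}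
    (hf : MemLp f P μ) : Tendsto (fun k : ℝ => μ {x | k < ‖f x‖}) atTop (𝓝 0) := by
  have hpos : 0 < P.toReal := ENNReal.toReal_pos hP0 hP
  have hlim : Tendsto (fun k : ℝ => eLpNorm f P μ ^ P.toReal / ENNReal.ofReal k ^ P.toReal) atTop
      (𝓝 0) := by
    have h1 : Tendsto (fun k : ℝ => ENNReal.ofReal k ^ P.toReal) atTop (𝓝 ⊤) := by
      have := ((ENNReal.continuous_rpow_const (y := P.toReal)).tendsto _).comp
        ENNReal.tendsto_ofReal_atTop
      simpa [Function.comp_def, ENNReal.top_rpow_of_pos hpos] using this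
    simpa using ENNReal.Tendsto.const_div (a := eLpNorm f P μ ^ P.toReal) h1
      (Or.inr (ENNReal.rpow_ne_top_of_nonneg hpos.le hf.2.ne))
  refine tendsto_of_tendsto_of_tendsto_of_le_of_le' tendsto_const_nhds hlim
    (Eventually.of_forall fun _ => zero_le) ?_
  filter_upwards [eventually_gt_atTop 0] with k hk
  have hk' : ENNReal.ofReal k ≠ 0 := by simpa using hk
  rw [ENNReal.le_div_iff_mul_le (Or.inl (by simp [hpos, hk, hpos.not_gt]))
    (Or.inl (ENNReal.rpow_ne_top_of_nonneg hpos.le ENNReal.ofReal_ne_top)), mul_comm]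
  refine le_trans ?_ (mul_meas_ge_le_pow_eLpNorm' μ hP0 hP hf.1 (ENNReal.ofReal k))
  gcongr with x
  intro hx
  rw [← ofReal_norm]
  exact ENNReal.ofReal_le_ofReal hx.le

theorem exists_measure_eq_zero_of_level_set_estimate {a : ℝ → ENNReal} (ha : Antitone a)
    (hlim : Tendsto a atTop (𝓝 0)) {M : NNReal} {p ε δ σ : ℝ} (hp : 0 < p) (hε : 0 < ε)
    (hσ : 0 < σ) (hδ : σ < δ)
    (h : ∀ k m h : ℝ, 0 < k → k < m → m < h → M * a k ^ ε ≤ 2⁻¹ →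
      ENNReal.ofReal (h - m) ^ p * a h ^ σ ≤ 2 * M * ENNReal.ofReal m ^ p * a k ^ δ) :
    ∃ K, a K = 0 := by
  -- The ratio `m / (h - m)` at step `n` will be at most `8 * 2 ^ n`; its `p`-th power accounts for
  -- `8 ^ p` and `B = 2 ^ p`. Writing `M + 1` keeps `C` positive when `M = 0`.
  obtain ⟨η, hη, hiter⟩ := exists_threshold_tendsto_zero (C := 2 * (M + 1) * 8 ^ p) (B := 2 ^ p)
    (β := δ / σ) (by positivity) (Real.one_lt_rpow one_lt_two hp) ((one_lt_div hσ).2 hδ)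
  have hrpow : ∀ {t : ℝ}, 0 < t → Tendsto (fun k => a k ^ t) atTop (𝓝 0) := fun {t} ht => by
    have := ((ENNReal.continuous_rpow_const (y := t)).tendsto _).comp hlim
    simpa [Function.comp_def, ht] using this
  have h1 : ∀ᶠ k in atTop, M * a k ^ ε ≤ 2⁻¹ := by
    have : Tendsto (fun k => (M : ENNReal) * a k ^ ε) atTop (𝓝 0) := by
      simpa using ENNReal.Tendsto.const_mul (a := (M : ENNReal)) (hrpow hε)
        (Or.inr ENNReal.coe_ne_top)
    exact (this.eventually_lt_const (by simp)).mono fun _ => le_of_lt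
  have h2 : ∀ᶠ k in atTop, a k ^ σ ≤ ENNReal.ofReal η :=
    ((hrpow hσ).eventually_lt_const (by simpa using hη)).mono fun _ => le_of_lt
  obtain ⟨K, hK1, hK2, hK0⟩ := (h1.and (h2.and (eventually_gt_atTop 0))).exists
  -- The levels increase from `K` towards `2 * K`, with `κ (n + 1) - κ n = K / 2 ^ (n + 1)`. The
  -- absorption condition at `K` passes to every `κ n` by antitonicity.
  set κ : ℕ → ℝ := fun n => K * (2 - (1 / 2) ^ n) with hκ
  have hpow : ∀ n : ℕ, (0 : ℝ) < (1 / 2) ^ n ∧ ((1 : ℝ) / 2) ^ n ≤ 1 := fun n =>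
    ⟨by positivity, pow_le_one₀ (by norm_num) (by norm_num)⟩
  have hκK : ∀ n, K ≤ κ n := fun n => by
    have := (hpow n).2
    simp only [hκ]
    nlinarith
  have hκ2 : ∀ n, κ n ≤ 2 * K := fun n => by
    have := (hpow n).1
    simp only [hκ]
    nlinarith
  have hc := hiter (fun n => a (κ n) ^ σ) (by simpa [hκ] using (by norm_num; exact hK2)) ?_
  · refine ⟨2 * K, ?_⟩
    have h3 : a (2 * K) ^ σ ≤ 0 := ge_of_tendsto' hc fun n =>
      ENNReal.rpow_le_rpow (ha (hκ2 n)) hσ.le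
    simpa [hσ, hσ.not_gt] using h3
  · intro n
    have hgap : κ (n + 1) - κ n = K * (1 / 2) ^ (n + 1) := by simp only [hκ]; ring
    have hgap0 : 0 < K * (1 / 2) ^ (n + 1) := mul_pos hK0 (hpow _).1
    -- The intermediate level `m` is the midpoint of `κ n` and `κ (n + 1)`, so `h - m = x = K / 2 ^
    -- (n + 2)`, while `m ≤ 2 * K = x * (8 * 2 ^ n)`.
    set x : ℝ := (κ (n + 1) - κ n) / 2 with hx
    have hx0 : 0 < x := by rw [hx, hgap]; positivity
    have h3 := h (κ n) (κ n + x) (κ (n + 1)) (hK0.trans_le (hκK n)) (by linarith) (by linarith)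
      (le_trans (by gcongr; exact ha (hκK n)) hK1)
    have h4 : κ (n + 1) - (κ n + x) = x := by rw [hx]; ring
    rw [h4] at h3
    have h5 : ENNReal.ofReal (κ n + x) ^ p ≤ ENNReal.ofReal x ^ p * ENNReal.ofReal (8 * 2 ^ n) ^ p := by
      rw [← ENNReal.mul_rpow_of_nonneg _ _ hp.le, ← ENNReal.ofReal_mul hx0.le]
      gcongr
      have h6 : x * (8 * 2 ^ n) = 2 * K := by
        rw [hx, hgap, pow_succ, div_pow, one_pow]
        field_simp
        norm_num
      rw [h6]
      linarith [hκ2 (n + 1)]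
    have h7 : ENNReal.ofReal x ^ p ≠ 0 := by simp [hx0, hp.not_gt]
    have h8 : ENNReal.ofReal x ^ p ≠ ⊤ := ENNReal.rpow_ne_top_of_nonneg hp.le ENNReal.ofReal_ne_top
    rw [← ENNReal.mul_le_mul_iff_right h7 h8]
    refine h3.trans ?_
    have h9 : (a (κ n) ^ σ) ^ (δ / σ) = a (κ n) ^ δ := by
      rw [← ENNReal.rpow_mul, mul_div_cancel₀ _ hσ.ne']
    have h10 : (2 : ENNReal) * M * ENNReal.ofReal (8 * 2 ^ n) ^ p ≤
        ENNReal.ofReal (2 * (M + 1) * 8 ^ p * (2 ^ p) ^ n) := by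
      have h11 : (2 * ((M : ℝ) + 1) * 8 ^ p * (2 ^ p) ^ n) = 2 * (M + 1) * (8 * 2 ^ n) ^ p := by
        rw [Real.mul_rpow (by norm_num) (by positivity), ← Real.rpow_natCast_mul (by norm_num),
          mul_comm (n : ℝ), Real.rpow_mul_natCast (by norm_num)]
        ring
      have hy : (0 : ℝ) < 8 * 2 ^ n := by positivity
      have hM1 : (0 : ℝ) ≤ M + 1 := by positivity
      rw [h11]
      generalize (8 * 2 ^ n : ℝ) = y at hy
      rw [ENNReal.ofReal_mul (mul_nonneg zero_le_two hM1), ENNReal.ofReal_mul zero_le_two,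
        ← ENNReal.ofReal_rpow_of_pos hy, ENNReal.ofReal_ofNat]
      gcongr
      rw [ENNReal.ofReal_add (by positivity) zero_le_one, ENNReal.ofReal_coe_nnreal]
      exact le_self_add
    rw [h9]
    calc 2 * M * ENNReal.ofReal (κ n + x) ^ p * a (κ n) ^ δ
        ≤ 2 * M * (ENNReal.ofReal x ^ p * ENNReal.ofReal (8 * 2 ^ n) ^ p) * a (κ n) ^ δ := by gcongr
      _ = ENNReal.ofReal x ^ p * ((2 * M * ENNReal.ofReal (8 * 2 ^ n) ^ p) * a (κ n) ^ δ) := by ring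
      _ ≤ _ := by gcongr

end MixedEigenvalue

theorem mainTheorem5 (N : ℕ) (hN : 2 ≤ N) (s p q : ℝ) (hs0 : 0 < s) (hs1 : s < 1)
    (hp1 : 1 < p) (hpN : p < N) (hq : (N : ℝ) / (s * p) < q)
    (Ω : Set (EuclideanSpace ℝ (Fin N))) (hΩo : IsOpen Ω) (hΩb : Bornology.IsBounded Ω)
    (hΩL : MixedEigenvalue.HasLipschitzBoundary Ω)
    (V g : EuclideanSpace ℝ (Fin N) → ℝ)
    (hV : MemLp V (ENNReal.ofReal q) (volume.restrict Ω))
    (hg : MemLp g (ENNReal.ofReal q) (volume.restrict Ω))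
    (hV0 : ∀ᵐ x ∂(volume.restrict Ω), 0 ≤ V x)
    (hg0 : ∀ᵐ x ∂(volume.restrict Ω), 0 < g x)
    (lam : ℝ) (hlam : 0 < lam)
    (u : EuclideanSpace ℝ (Fin N) → ℝ)
    (hu : MixedEigenvalue.IsEigenfunction s p Ω V g lam u) :
    MemLp u ⊤ (volume : Measure (EuclideanSpace ℝ (Fin N))) := by
  have hp0 : 0 < p := by linarith
  have hNpos : (0 : ℝ) < N := by linarith
  -- As `s < 1`, the assumption `q > N / (s p)` is stronger than the local condition `q > N / p`.
  have hqN : (N : ℝ) / p < q := by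
    refine lt_of_le_of_lt ?_ hq
    gcongr
    exact mul_le_of_le_one_left hp0.le hs1.le
  have hNp : 1 < (N : ℝ) / p := (one_lt_div hp0).2 hpN
  have hinv : 0 < p⁻¹ - (N : ℝ)⁻¹ := sub_pos.2 (inv_strictAnti₀ hp0 hpN)
  have hqinv : 1 / q < p / N := by
    rw [← one_div_div (N : ℝ) p]
    exact one_div_lt_one_div_of_lt (by linarith) hqN
  obtain ⟨M, hM⟩ := hu.1.exists_level_set_estimate (r := (p⁻¹ - (N : ℝ)⁻¹)⁻¹) hp1 (by omega) hqN
    (inv_pos.2 hinv) (inv_inv _) hpN hΩo hlam.le hV0 hg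
  have huW := hu.1.1.memW1p.1
  rw [Measure.restrict_univ] at huW
  -- The iteration needs `σ < δ` with `σ = p / r = 1 - p / N` and `δ = 1 - 1 / q`, which is again `q
  -- > N / p`.
  have hratio : p / (p⁻¹ - (N : ℝ)⁻¹)⁻¹ = 1 - p / N := by
    rw [div_inv_eq_mul, mul_sub, mul_inv_cancel₀ hp0.ne', div_eq_mul_inv]
  obtain ⟨K, hK⟩ := MixedEigenvalue.exists_measure_eq_zero_of_level_set_estimate
    (a := fun k => volume {x | k < ‖u x‖})
    (fun k l hkl => measure_mono fun x hx => lt_of_le_of_lt hkl hx)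
    (MixedEigenvalue.tendsto_measure_lt_norm_atTop (by simpa using hp0) ENNReal.ofReal_ne_top huW)
    hp0 (sub_pos.2 hqinv) (by positivity) (by rw [hratio]; linarith) hM
  refine memLp_top_of_bound huW.1 K ?_
  filter_upwards [measure_eq_zero_iff_ae_notMem.1 hK] with x hx
  exact not_lt.1 hx
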